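/- \textbf{Setting.} Let $n\ge 1$. Signals are sequences $x:\mathbb N\to\mathbb R^n$, $P_T$ is truncation after time $T$, and $\|x\|_\infty=\sup_t\max_i|x_i(t)|$. For a causal linear operator $\mathbf H$ on signals (scalar or $\mathbb R^n$-valued) put $\|\mathbf H\|_1=\sup_T\sup_{P_Tx\ne0}\|P_T\mathbf Hx\|_\infty/\|P_Tx\|_\infty$; $\mathbf H$ is stable if $\|\mathbf H\|_1<\infty$. The magnitude matrix of a stable system $\mathbf G$ is $M_G=(\|\mathbf G_{ij}\|_1)_{ij}$, where $\mathbf G_{ij}$ is the scalar operator from input $j$ to output $i$. Let $\mathscr D$ be the set of stable causal linear (possibly time-varying) operators $\boldsymbol\Delta$ with zero off-diagonal entries, and let $\boldsymbol\delta_i$ denote the $i$-th diagonal entry of $\boldsymbol\Delta$. Define $$\nu(\mathbf G)=\frac1{\inf\{\sum_{i=1}^n\|\boldsymbol\delta_i\|_1:\ \boldsymbol\Delta\in\mathscr D,\ I-\mathbf G\boldsymbol\Delta\text{ has no stable causal inverse}\}},\qquad \overline\nu(\mathbf G)=\inf_{D}|DM_GD^{-1}|_{1,\infty},$$ where $\inf\emptyset=\infty$,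 $1/\infty=0$, $D$ ranges over the diagonal matrices with positive diagonal, and $|A|_{1,\infty}=\sup_{x\ne0}|Ax|_\infty/|x|_1$. A matrix is diagonally maximal if an entry of maximal absolute value lies on its diagonal. $\mathbf G$ is a pure ring if there is a permutation $\sigma$ of $\{1,\dots,n\}$ consisting of a single $n$-cycle such that $\mathbf G_{ij}\ne0$ if and only if $j=\sigma(i)$. \textbf{Theorem.} Let $\mathbf G$ be a stable causal linear time-invariant system with $n$ inputs and $n$ outputs. 1. $\nu(\mathbf G)\le\overline\nu(\mathbf G)\le n\,\nu(\mathbf G)$ and $\overline\nu(\mathbf G)<\infty$; hence $1\le\overline\nu(\mathbf G)/\nu(\mathbf G)\le n$ whenever $\nu(\mathbf G)\neq0$. 2. If $DM_GD^{-1}$ is diagonally maximal for some invertible diagonal matrix $D$, then $\overline\nu(\mathbf G)=\nu(\mathbf G)$; if moreover $\mathbf G\ne0$, then $\overline\nu(\mathbf G)/\nu(\mathbf G)=1$. 3. If $\mathbf G$ is a pure ring, then $\overline\nu(\mathbf G)/\nu(\mathbf G)=n$. If in addition the links are normalized, i.e. $\|\mathbf G_{i\sigma(i)}\|_1=1$ for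 all $i$, then for all $\delta_{11},\dots,\delta_{nn}\ge0$ and $\Delta=\operatorname{diag}(\delta_{11},\dots,\delta_{nn})$ the matrix $I-M_G\Delta$ is singular if and only if $\delta_{11}\cdots\delta_{nn}=1$, and in that case $\sum_{i=1}^n\delta_{ii}\ge n$. -/

import Mathlib

open scoped ENNReal

noncomputable section

namespace NuGap

/-- Discrete-time signals, that is, arbitrary sequences (the extended space). The value space
`Fin n → ℝ` carries the max norm. -/
abbrev Signal (E : Type) : Type := ℕ → E

/-- Linear operators on signals. -/
abbrev Op (E F : Type) [NormedAddCommGroup E] [NormedSpace ℝ E]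
    [NormedAddCommGroup F] [NormedSpace ℝ F] : Type :=
  Signal E →ₗ[ℝ] Signal F

/-- Linear systems with `n` inputs and `n` outputs. -/
abbrev Sys (n : ℕ) : Type := Op (Fin n → ℝ) (Fin n → ℝ)

section Generic

variable {E F : Type} [NormedAddCommGroup E] [NormedSpace ℝ E]
  [NormedAddCommGroup F] [NormedSpace ℝ F]

/-- The truncation `P_T x = (x 0, …, x T, 0, 0, …)`. -/
def trunc (T : ℕ) (x : Signal E) : Signal E := fun t => if t ≤ T then x t else 0

/-- The peak norm `‖x‖_∞`, with value `∞` for unbounded signals. -/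
def peak (x : Signal E) : ℝ≥0∞ := ⨆ t, ‖x t‖ₑ

/-- The one-step delay, `(x 0, x 1, …) ↦ (0, x 0, x 1, …)`. -/
def delay (x : Signal E) : Signal E := fun t => if t = 0 then 0 else x (t - 1)

/-- Causality: `P_T H = P_T H P_T` for every `T`. -/
def Causal (H : Op E F) : Prop := ∀ T x, trunc T (H x) = trunc T (H (trunc T x))

/-- Time invariance: `H` commutes with the delay. -/
def TimeInvariant (H : Op E F) : Prop := ∀ x, H (delay x) = delay (H x)

/-- The induced norm `sup_T sup_x ‖P_T H x‖_∞ / ‖P_T x‖_∞` (with `0 / 0 = 0`); for a causal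
operator the numerator is zero whenever the denominator is. -/
def indNorm (H : Op E F) : ℝ≥0∞ :=
  ⨆ (T : ℕ) (x : Signal E), peak (trunc T (H x)) / peak (trunc T x)

/-- Stability: finite induced norm. -/
def Stable (H : Op E F) : Prop := indNorm H < ∞

end Generic

/-- The scalar operator from input `j` to output `i`. -/
def entry {n : ℕ} (H : Sys n) (i j : Fin n) : Op ℝ ℝ where
  toFun x := fun t => H (fun s => Pi.single j (x s)) t i
  map_add' x y := by
    have h : (fun s => Pi.single j ((x + y) s) : Signal (Fin n → ℝ))
        = (fun s => Pi.single j (x s)) + (fun s => Pi.single j (y s)) := by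
      funext s
      simp [Pi.single_add]
    funext t
    rw [h, map_add]
    rfl
  map_smul' c x := by
    have h : (fun s => Pi.single j ((c • x) s) : Signal (Fin n → ℝ))
        = c • (fun s => Pi.single j (x s) : Signal (Fin n → ℝ)) := by
      funext s
      exact Pi.single_smul' j c (x s)
    funext t
    rw [h, map_smul]
    rfl

/-- The magnitude matrix: the induced norms of the entries (all finite for a stable system). -/
def magMatrix {n : ℕ} (H : Sys n) : Matrix (Fin n) (Fin n) ℝ :=
  Matrix.of fun i j => (indNorm (entry H i j)).toReal

/-- Stable causal linear time-varying operators whose off-diagonal entries are zero. -/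
def diagLTV (n : ℕ) : Set (Sys n) :=
  {Δ | Causal Δ ∧ Stable Δ ∧ ∀ i j, i ≠ j → entry Δ i j = 0}

/-- `(I - G Δ)⁻¹` exists as a stable causal operator. -/
def LoopStable {n : ℕ} (G Δ : Sys n) : Prop :=
  ∃ K : Sys n, Causal K ∧ Stable K ∧
    (LinearMap.id - G ∘ₗ Δ) ∘ₗ K = LinearMap.id ∧
    K ∘ₗ (LinearMap.id - G ∘ₗ Δ) = LinearMap.id

/-- The robustness measure `ν`, with the conventions `inf ∅ = ∞`, `1 / ∞ = 0` and `1 / 0 = ∞`. -/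
def nu {n : ℕ} (G : Sys n) : ℝ≥0∞ :=
  1 / sInf {s | ∃ Δ ∈ diagLTV n, ¬ LoopStable G Δ ∧ s = ∑ i, indNorm (entry Δ i i)}

/-- The matrix norm induced by the 1-norm on the domain and the max norm on the codomain. -/
def oneInfNorm {n : ℕ} (A : Matrix (Fin n) (Fin n) ℝ) : ℝ≥0∞ :=
  ⨆ x : Fin n → ℝ, ‖A.mulVec x‖ₑ / ∑ j, ‖x j‖ₑ

/-- `D A D⁻¹` for `D = diag d`, where all `d i` are nonzero. -/
def diagConj {n : ℕ} (d : Fin n → ℝ) (A : Matrix (Fin n) (Fin n) ℝ) :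
    Matrix (Fin n) (Fin n) ℝ :=
  Matrix.diagonal d * A * Matrix.diagonal (fun i => (d i)⁻¹)

/-- The upper bound `ν̄`: the infimum over positive diagonal scalings of the magnitude matrix. -/
def nuBar {n : ℕ} (G : Sys n) : ℝ≥0∞ :=
  ⨅ (d : Fin n → ℝ) (_ : ∀ i, 0 < d i), oneInfNorm (diagConj d (magMatrix G))

/-- An entry of maximal absolute value lies on the diagonal. -/
def DiagonallyMaximal {n : ℕ} (A : Matrix (Fin n) (Fin n) ℝ) : Prop :=
  ∃ k, ∀ i j, |A i j| ≤ |A k k|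

/-- Pure ring: `σ` permutes all `n` signals in a single cycle (for `n = 1`, a self-loop), and
output `i` is driven exactly by input `σ i`, through an arbitrary nonzero scalar link. -/
def IsPureRing {n : ℕ} (G : Sys n) (σ : Equiv.Perm (Fin n)) : Prop :=
  σ.IsCycleOn Set.univ ∧ ∀ i j, entry G i j ≠ 0 ↔ j = σ i

end NuGap

end

/-! Write M for the magnitude matrix; `oneInfNorm` is the largest absolute entry.

Lower bound: if every entry of D M D⁻¹ is at most m, then each row sum of D M |Δ| D⁻¹ is at most m ∑
‖δ_j‖. When this is below 1 the loop contracts a weighted max norm and the Neumann series inverts it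
(`loopStable_of_weights`), so ν ≤ ν̄.

Upper bound: for μ' > 0, either potentials d satisfy d_i M_ij ≤ μ' d_j, so that ν̄ ≤ μ', or the
products of M_ij / μ' along walks are unbounded (`exists_potential_or_unbounded`). In the second
case a perturbation with all ‖δ_i‖ ≤ 1/μ, where μ < μ', destabilizes the loop
(`exists_not_loopStable`). Its cost is at most n/μ, whence ν̄ ≤ n ν.

The destabilizing signal follows a walk that contains every finite word. In successive time windows
one channel drives the next through a nearly optimal probe, and a bounded input u adds a unit
impulse with a favourable sign. The loop signal x = u + G w is unbounded, while a time-varying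
diagonal Δ within the gain bounds gives Δ x = w. Thus (I - GΔ) x = u has bounded u and unbounded x,
which excludes a stable inverse.

A walk that stays at k gives M_kk ≤ ν, which settles the diagonally maximal case. On a ring only the
product of the gains around the cycle matters: potentials equalize the links to their geometric
mean, and the AM-GM inequality supplies the factor n. -/

noncomputable section

namespace NuGap

/-! ### Truncation, peak norm and delay. -/

section Signals

variable {E : Type} [NormedAddCommGroup E]

lemma peak_trunc_le {x : Signal E} {T : ℕ} {b : ℝ} (h : ∀ s ≤ T, ‖x s‖ ≤ b) :
    peak (trunc T x) ≤ ENNReal.ofReal b := by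
  refine iSup_le fun t => ?_
  by_cases ht : t ≤ T
  · simp only [trunc, ht, if_true]
    rw [← ofReal_norm]
    exact ENNReal.ofReal_le_ofReal (h t ht)
  · simp [trunc, ht]

lemma peak_trunc_ne_top (x : Signal E) (T : ℕ) : peak (trunc T x) ≠ ∞ := by
  refine ne_top_of_le_ne_top ENNReal.ofReal_ne_top
    (peak_trunc_le (b := ∑ s ∈ Finset.range (T + 1), ‖x s‖) fun s hs => ?_)
  exact Finset.single_le_sum (f := fun s => ‖x s‖) (fun _ _ => norm_nonneg _)
    (Finset.mem_range.2 (Nat.lt_succ_of_le hs))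

lemma enorm_le_peak_trunc (x : Signal E) {s T : ℕ} (hs : s ≤ T) :
    ‖x s‖ₑ ≤ peak (trunc T x) := by
  have := le_iSup (fun t => ‖trunc T x t‖ₑ) s
  simpa [trunc, hs, peak] using this

lemma norm_le_peak_trunc (x : Signal E) {s T : ℕ} (hs : s ≤ T) :
    ‖x s‖ ≤ (peak (trunc T x)).toReal := by
  rw [← toReal_enorm]
  exact ENNReal.toReal_mono (peak_trunc_ne_top x T) (enorm_le_peak_trunc x hs)

lemma delay_iterate_apply (k : ℕ) (x : Signal E) (t : ℕ) :
    delay^[k] x t = if t < k then 0 else x (t - k) := by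
  induction k generalizing t with
  | zero => simp
  | succ k ih =>
    rw [Function.iterate_succ_apply']
    unfold delay
    by_cases ht : t = 0
    · simp [ht]
    · rw [if_neg ht]
      have := ih (t - 1)
      rw [show delay = fun (x : Signal E) t => if t = 0 then 0 else x (t - 1) from rfl] at this
      rw [this]
      have h1 : t - 1 < k ↔ t < k + 1 := by omega
      simp only [h1]
      congr 2
      omega

end Signals

/-! ### Causal and stable operators, horizon by horizon. -/

section Generic

variable {E F : Type} [NormedAddCommGroup E] [NormedSpace ℝ E]
  [NormedAddCommGroup F] [NormedSpace ℝ F]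

lemma Causal.congr {H : Op E F} (hH : Causal H) {T : ℕ} {x y : Signal E}
    (h : ∀ s ≤ T, x s = y s) : H x T = H y T := by
  have hxy : trunc T x = trunc T y := by
    funext s
    by_cases hs : s ≤ T
    · simp [trunc, hs, h s hs]
    · simp [trunc, hs]
  have h1 := congrFun (hH T x) T
  have h2 := congrFun (hH T y) T
  rw [hxy, ← h2] at h1
  simpa [trunc] using h1

lemma causal_of_congr {H : Op E F}
    (h : ∀ T x y, (∀ s ≤ T, x s = y s) → H x T = H y T) : Causal H := by
  intro T x
  funext s
  by_cases hs : s ≤ T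
  · simp only [trunc, hs, if_true]
    refine h s _ _ fun u hu => ?_
    simp [trunc, hu.trans hs]
  · simp [trunc, hs]

lemma Stable.norm_apply_le {H : Op E F} (hH : Stable H) {T : ℕ} {x : Signal E} {b : ℝ}
    (h : ∀ s ≤ T, ‖x s‖ ≤ b) : ‖H x T‖ ≤ (indNorm H).toReal * b := by
  have hb : 0 ≤ b := (norm_nonneg _).trans (h 0 (Nat.zero_le _))
  have h1 : peak (trunc T (H x)) / peak (trunc T x) ≤ indNorm H :=
    le_iSup₂ (f := fun (T : ℕ) (x : Signal E) => peak (trunc T (H x)) / peak (trunc T x)) T x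
  -- A zero denominator is harmless: the quotient is bounded by a finite number, so the numerator
  -- must vanish too.
  have h2 : peak (trunc T (H x)) ≤ indNorm H * peak (trunc T x) :=
    (ENNReal.div_le_iff_le_mul (Or.inr hH.ne) (Or.inl (peak_trunc_ne_top x T))).1 h1
  have h3 : ‖H x T‖ₑ ≤ indNorm H * ENNReal.ofReal b :=
    (enorm_le_peak_trunc (H x) le_rfl).trans (h2.trans (by gcongr; exact peak_trunc_le h))
  have h4 := ENNReal.toReal_mono (ENNReal.mul_ne_top hH.ne ENNReal.ofReal_ne_top) h3
  rwa [toReal_enorm, ENNReal.toReal_mul, ENNReal.toReal_ofReal hb] at h4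

lemma indNorm_le {H : Op E F} {C : ℝ}
    (h : ∀ T x b, (∀ s ≤ T, ‖x s‖ ≤ b) → ‖H x T‖ ≤ C * b) :
    indNorm H ≤ ENNReal.ofReal C := by
  refine iSup₂_le fun T x => ENNReal.div_le_of_le_mul ?_
  have h1 : ∀ s ≤ T, ‖H x s‖ ≤ C * (peak (trunc T x)).toReal := fun s hs =>
    h s x _ fun u hu => norm_le_peak_trunc x (hu.trans hs)
  refine (peak_trunc_le h1).trans ?_
  rw [ENNReal.ofReal_mul' ENNReal.toReal_nonneg, ENNReal.ofReal_toReal (peak_trunc_ne_top x T)]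

lemma eq_zero_of_indNorm_eq_zero {H : Op E F} (h : indNorm H = 0) : H = 0 := by
  have hs : Stable H := by simp [Stable, h]
  refine LinearMap.ext fun x => funext fun T => ?_
  have := hs.norm_apply_le fun s (hs : s ≤ T) => norm_le_peak_trunc x hs
  rw [h] at this
  simpa using this

lemma exists_lt_norm_apply {H : Op E F} {c : ℝ} (hc : 0 ≤ c)
    (h : c < (indNorm H).toReal) :
    ∃ (N : ℕ) (v : Signal E), (∀ s ≤ N, ‖v s‖ ≤ 1) ∧ c < ‖H v N‖ := by
  by_contra! hcon
  have hle : indNorm H ≤ ENNReal.ofReal c := by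
    refine indNorm_le fun T x b hb => ?_
    have hb0 : 0 ≤ b := (norm_nonneg _).trans (hb 0 (Nat.zero_le _))
    -- Normalizing by b' > b instead of b covers b = 0; the bound for b follows in the limit.
    have key : ∀ b' > b, ‖H x T‖ ≤ c * b' := fun b' hb' => by
      have hb'0 : 0 < b' := hb0.trans_lt hb'
      have := hcon T (b'⁻¹ • x) fun s hs => by
        rw [Pi.smul_apply, norm_smul, Real.norm_of_nonneg (inv_nonneg.2 hb'0.le),
          inv_mul_le_iff₀ hb'0, mul_one]
        exact (hb s hs).trans hb'.le
      rw [map_smul, Pi.smul_apply, norm_smul, Real.norm_of_nonneg (inv_nonneg.2 hb'0.le),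
          inv_mul_le_iff₀ hb'0] at this
      linarith
    have ht : Filter.Tendsto (fun b' => c * b') (nhdsWithin b (Set.Ioi b)) (nhds (c * b)) :=
      ((continuous_const.mul continuous_id).tendsto b).mono_left nhdsWithin_le_nhds
    exact ge_of_tendsto ht (Filter.eventually_of_mem self_mem_nhdsWithin key)
  exact absurd (ENNReal.toReal_le_of_le_ofReal hc hle) (not_le.2 h)

lemma TimeInvariant.iterate {H : Op E F} (hH : TimeInvariant H) (k : ℕ) (x : Signal E) :
    H (delay^[k] x) = delay^[k] (H x) := by
  induction k with
  | zero => rfl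
  | succ k ih => rw [Function.iterate_succ_apply', hH, ih, Function.iterate_succ_apply']

end Generic

/-! ### Scalar entries, Neumann series and the weighted small gain theorem. -/

section Entries

variable {n : ℕ}

lemma entry_apply (H : Sys n) (i j : Fin n) (x : Signal ℝ) (t : ℕ) :
    entry H i j x t = H (fun s => Pi.single j (x s)) t i := rfl

lemma apply_eq_sum_entry (H : Sys n) (x : Signal (Fin n → ℝ)) (t : ℕ) (i : Fin n) :
    H x t i = ∑ j, entry H i j (fun s => x s j) t := by
  have hx : x = ∑ j, (fun s => Pi.single j (x s j) : Signal (Fin n → ℝ)) := by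
    funext s
    rw [Finset.sum_apply]
    exact (Finset.univ_sum_single (x s)).symm
  conv_lhs => rw [hx, map_sum, Finset.sum_apply, Finset.sum_apply]
  rfl

lemma Stable.entry {H : Sys n} (hH : Stable H) (i j : Fin n) : Stable (entry H i j) := by
  refine (indNorm_le (C := (indNorm H).toReal) fun T x b hb => ?_).trans_lt ENNReal.ofReal_lt_top
  rw [entry_apply]
  refine (norm_le_pi_norm _ i).trans (hH.norm_apply_le fun s hs => ?_)
  rw [Pi.norm_single]
  exact hb s hs

lemma magMatrix_nonneg (H : Sys n) (i j : Fin n) : 0 ≤ magMatrix H i j :=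
  ENNReal.toReal_nonneg

lemma Stable.abs_entry_le {H : Sys n} (hH : Stable H) (i j : Fin n) {T : ℕ} {x : Signal ℝ}
    {b : ℝ} (h : ∀ s ≤ T, |x s| ≤ b) : |NuGap.entry H i j x T| ≤ magMatrix H i j * b :=
  (hH.entry i j).norm_apply_le h

lemma magMatrix_eq_zero_iff {H : Sys n} (hH : Stable H) (i j : Fin n) :
    magMatrix H i j = 0 ↔ entry H i j = 0 := by
  constructor
  · intro h
    refine eq_zero_of_indNorm_eq_zero ?_
    have h' : (indNorm (entry H i j)).toReal = 0 := h
    exact ((ENNReal.toReal_eq_zero_iff _).1 h').resolve_right (hH.entry i j).ne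
  · intro h
    have h2 : indNorm (0 : Op ℝ ℝ) ≤ ENNReal.ofReal 0 :=
      indNorm_le fun T x b _ => by simp
    have h3 : indNorm (entry H i j) = 0 := by
      rw [h]; simpa using h2
    simp [magMatrix, h3]

/-- Neumann series for an operator that contracts a weighted max norm on every horizon. -/
lemma exists_inverse_of_contraction {H : Sys n} {d : Fin n → ℝ} (hd : ∀ i, 0 < d i) {c : ℝ}
    (hc0 : 0 ≤ c) (hc1 : c < 1)
    (hH : ∀ T x B, (∀ s ≤ T, ∀ i, d i * |x s i| ≤ B) → ∀ i, d i * |H x T i| ≤ c * B) :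
    ∃ K : Sys n, Causal K ∧ Stable K ∧
      (LinearMap.id - H) ∘ₗ K = LinearMap.id ∧ K ∘ₗ (LinearMap.id - H) = LinearMap.id := by
  have hpow : ∀ k T x B, (∀ s ≤ T, ∀ i, d i * |x s i| ≤ B) →
      ∀ s ≤ T, ∀ i, d i * |(H ^ k) x s i| ≤ c ^ k * B := by
    intro k
    induction k with
    | zero => intro T x B h s hs i; simpa using h s hs i
    | succ k ih =>
      intro T x B h s hs i
      rw [pow_succ', Module.End.mul_apply, pow_succ', mul_assoc]
      exact hH s _ _ (fun u hu i => ih T x B h u (hu.trans hs) i) i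
  have hbd : ∀ (T : ℕ) (x : Signal (Fin n → ℝ)), ∃ B, ∀ s ≤ T, ∀ i, d i * |x s i| ≤ B := by
    intro T x
    refine ⟨∑ s ∈ Finset.range (T + 1), ∑ i, d i * |x s i|, fun s hs i => ?_⟩
    refine le_trans ?_ (Finset.single_le_sum (f := fun s => ∑ i, d i * |x s i|)
      (fun _ _ => Finset.sum_nonneg fun i _ => mul_nonneg (hd i).le (abs_nonneg _))
      (Finset.mem_range.2 (Nat.lt_succ_of_le hs)))
    exact Finset.single_le_sum (f := fun i => d i * |x s i|)
      (fun i _ => mul_nonneg (hd i).le (abs_nonneg _)) (Finset.mem_univ i)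
  have hgeo := summable_geometric_of_lt_one hc0 hc1
  have habs : ∀ T x B, (∀ s ≤ T, ∀ i, d i * |x s i| ≤ B) → ∀ i k,
      ‖(H ^ k) x T i‖ ≤ c ^ k * (B / d i) := by
    intro T x B h i k
    rw [Real.norm_eq_abs, ← mul_div_assoc, le_div_iff₀ (hd i), mul_comm]
    exact hpow k T x B h T le_rfl i
  have hsum : ∀ x T i, Summable fun k => (H ^ k) x T i := by
    intro x T i
    obtain ⟨B, hB⟩ := hbd T x
    exact Summable.of_norm_bounded (hgeo.mul_right _) (habs T x B hB i)
  let K : Sys n :=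
    { toFun := fun x T i => ∑' k, (H ^ k) x T i
      map_add' := fun x y => by
        funext T i
        simp only [map_add, Pi.add_apply]
        exact (hsum x T i).tsum_add (hsum y T i)
      map_smul' := fun a x => by
        funext T i
        simp only [map_smul, Pi.smul_apply, smul_eq_mul, RingHom.id_apply]
        exact tsum_mul_left }
  have hKdef : ∀ x T i, K x T i = ∑' k, (H ^ k) x T i := fun _ _ _ => rfl
  have hKb : ∀ T x B, (∀ s ≤ T, ∀ i, d i * |x s i| ≤ B) →
      ∀ i, d i * |K x T i| ≤ (1 - c)⁻¹ * B := by
    intro T x B h i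
    have h1 : ‖∑' k, (H ^ k) x T i‖ ≤ ∑' k, c ^ k * (B / d i) :=
      tsum_of_norm_bounded ((hgeo.mul_right _).hasSum) (habs T x B h i)
    rw [tsum_mul_right, tsum_geometric_of_lt_one hc0 hc1, Real.norm_eq_abs, ← mul_div_assoc,
      le_div_iff₀ (hd i), mul_comm] at h1
    exact h1
  -- Splitting off the zeroth term of the series; by linearity of K this is the left-inverse
  -- identity.
  have hKH : ∀ x, K x = x + K (H x) := by
    intro x
    funext T i
    rw [Pi.add_apply, Pi.add_apply, hKdef, hKdef, (hsum x T i).tsum_eq_zero_add]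
    simp [pow_succ, Module.End.mul_apply]
  refine ⟨K, ?_, ?_, ?_, ?_⟩
  -- Causality is the bound `hKb` with B = 0, applied to x - y.
  · refine causal_of_congr fun T x y hxy => ?_
    rw [← sub_eq_zero, ← Pi.sub_apply, ← map_sub]
    funext i
    have := hKb T (x - y) 0 (fun s hs i => by simp [hxy s hs]) i
    rw [mul_zero] at this
    have h2 := nonpos_of_mul_nonpos_right this (hd i)
    simpa using h2
  · refine (indNorm_le (C := (∑ i, (d i)⁻¹) * ((1 - c)⁻¹ * ∑ i, d i))
      fun T x b hb => ?_).trans_lt ENNReal.ofReal_lt_top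
    have hb0 : 0 ≤ b := (norm_nonneg _).trans (hb 0 (Nat.zero_le _))
    have hc' : 0 ≤ (1 - c)⁻¹ := inv_nonneg.2 (sub_nonneg.2 hc1.le)
    have hD : 0 ≤ ∑ i, d i := Finset.sum_nonneg fun i _ => (hd i).le
    have hD' : 0 ≤ ∑ i, (d i)⁻¹ := Finset.sum_nonneg fun i _ => (inv_pos.2 (hd i)).le
    refine (pi_norm_le_iff_of_nonneg (by positivity)).2 fun i => ?_
    have h1 := hKb T x ((∑ i, d i) * b) (fun s hs i => by
      refine mul_le_mul ?_ ((norm_le_pi_norm (x s) i).trans (hb s hs)) (abs_nonneg _) hD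
      exact Finset.single_le_sum (f := d) (fun i _ => (hd i).le) (Finset.mem_univ i)) i
    have h2 : (d i)⁻¹ ≤ ∑ i, (d i)⁻¹ := Finset.single_le_sum (f := fun i => (d i)⁻¹)
      (fun i _ => (inv_pos.2 (hd i)).le) (Finset.mem_univ i)
    rw [← le_inv_mul_iff₀ (hd i)] at h1
    refine h1.trans ((mul_le_mul_of_nonneg_right h2 (by positivity)).trans_eq (by ring))
  -- To avoid passing H through an infinite sum, consider the residual R of the right-inverse
  -- identity. It satisfies R = R H, hence R = R Hᵏ, and R is bounded on each horizon while Hᵏ x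
  -- tends to 0 there.
  · let R : Sys n := (LinearMap.id - H) ∘ₗ K - LinearMap.id
    have hR : ∀ x, R x = K x - H (K x) - x := fun x => rfl
    have hRH : ∀ x, R x = R (H x) := fun x => by
      rw [hR, hR, hKH x, map_add]; abel
    have hRk : ∀ k x, R x = R ((H ^ k) x) := by
      intro k
      induction k with
      | zero => intro x; rfl
      | succ k ih => intro x; rw [pow_succ', Module.End.mul_apply, ← hRH, ih]
    have hRb : ∀ T x B, (∀ s ≤ T, ∀ i, d i * |x s i| ≤ B) →
        ∀ i, d i * |R x T i| ≤ ((1 - c)⁻¹ + c * (1 - c)⁻¹ + 1) * B := by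
      intro T x B h i
      have h1 : ∀ s ≤ T, ∀ i, d i * |K x s i| ≤ (1 - c)⁻¹ * B := fun s hs i =>
        hKb s x B (fun u hu i => h u (hu.trans hs) i) i
      have h2 := hH T (K x) _ h1 i
      have h3 := h T le_rfl i
      have h4 := h1 T le_rfl i
      have h5 : |R x T i| ≤ |K x T i| + |H (K x) T i| + |x T i| := by
        rw [hR]
        exact (abs_sub _ _).trans (add_le_add_left (abs_sub _ _) _)
      have h6 := mul_le_mul_of_nonneg_left h5 (hd i).le
      linarith
    suffices hz : R = 0 from sub_eq_zero.1 hz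
    refine LinearMap.ext fun x => funext fun T => funext fun i => ?_
    obtain ⟨B, hB⟩ := hbd T x
    have h1 : ∀ k : ℕ, d i * |R x T i| ≤ ((1 - c)⁻¹ + c * (1 - c)⁻¹ + 1) * (c ^ k * B) :=
      fun k => by
        rw [hRk k x]
        exact hRb T _ _ (hpow k T x B hB) i
    have h2 : Filter.Tendsto (fun k : ℕ => ((1 - c)⁻¹ + c * (1 - c)⁻¹ + 1) * (c ^ k * B))
        Filter.atTop (nhds 0) := by
      simpa using ((tendsto_pow_atTop_nhds_zero_of_lt_one hc0 hc1).mul_const B).const_mul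
        ((1 - c)⁻¹ + c * (1 - c)⁻¹ + 1)
    have h3 := ge_of_tendsto' h2 h1
    have h4 := nonpos_of_mul_nonpos_right h3 (hd i)
    simpa using h4
  · refine LinearMap.ext fun x => ?_
    change K (x - H x) = x
    rw [map_sub, hKH x]
    abel

lemma diagLTV.apply {Δ : Sys n} (hΔ : Δ ∈ diagLTV n) (x : Signal (Fin n → ℝ)) (t : ℕ)
    (i : Fin n) : Δ x t i = entry Δ i i (fun s => x s i) t := by
  rw [apply_eq_sum_entry, Finset.sum_eq_single i]
  · intro j _ hj
    rw [hΔ.2.2 i j hj.symm]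
    rfl
  · simp

/-- Small gain theorem with diagonal weights. -/
lemma loopStable_of_weights {G Δ : Sys n} (hG : Stable G) (hΔ : Δ ∈ diagLTV n)
    {d : Fin n → ℝ} (hd : ∀ i, 0 < d i) {c : ℝ} (hc0 : 0 ≤ c) (hc1 : c < 1)
    (h : ∀ i, ∑ j, d i * magMatrix G i j * magMatrix Δ j j / d j ≤ c) : LoopStable G Δ := by
  refine exists_inverse_of_contraction hd hc0 hc1 fun T x B hB i => ?_
  have hB0 : 0 ≤ B :=
    (mul_nonneg (hd i).le (abs_nonneg _)).trans (hB 0 (Nat.zero_le _) i)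
  rw [LinearMap.comp_apply, apply_eq_sum_entry]
  have h1 : ∀ j, ∀ s ≤ T, |Δ x s j| ≤ magMatrix Δ j j * (B / d j) := fun j s hs => by
    rw [diagLTV.apply hΔ]
    refine hΔ.2.1.abs_entry_le j j fun u hu => ?_
    rw [le_div_iff₀ (hd j), mul_comm]
    exact hB u (hu.trans hs) j
  calc d i * |∑ j, entry G i j (fun s => Δ x s j) T|
      ≤ d i * ∑ j, magMatrix G i j * (magMatrix Δ j j * (B / d j)) := by
        refine mul_le_mul_of_nonneg_left ((Finset.abs_sum_le_sum_abs _ _).trans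
          (Finset.sum_le_sum fun j _ => hG.abs_entry_le i j (h1 j))) (hd i).le
    _ = (∑ j, d i * magMatrix G i j * magMatrix Δ j j / d j) * B := by
        rw [Finset.mul_sum, Finset.sum_mul]
        exact Finset.sum_congr rfl fun j _ => by ring
    _ ≤ c * B := mul_le_mul_of_nonneg_right (h i) hB0

end Entries

/-- A sequence that contains every finite word. -/
lemma exists_universal_sequence (α : Type) [Encodable α] [Nonempty α] :
    ∃ p : ℕ → α, ∀ (f : ℕ → α) (K : ℕ), ∃ q, 1 ≤ q ∧ ∀ t ≤ K, p (q + t) = f t := by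
  obtain ⟨a⟩ := ‹Nonempty α›
  -- The b-th block occupies the indices from b² up to (b + 1)² - 1 and spells the word coded by the
  -- first component of b. Pairing the code with K + 1 makes b ≥ K + 1, so the block is long enough.
  refine ⟨fun m => ((Encodable.decode (α := List α) (Nat.unpair (Nat.sqrt m)).1).getD []).getD
    (m - Nat.sqrt m * Nat.sqrt m) a, fun f K => ?_⟩
  let l := (List.range (K + 1)).map f
  let b := Nat.pair (Encodable.encode l) (K + 1)
  have hb : K + 1 ≤ b := Nat.right_le_pair _ _
  refine ⟨b * b, Nat.mul_pos (by omega) (by omega), fun t ht => ?_⟩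
  have hs : Nat.sqrt (b * b + t) = b := Nat.sqrt_add_eq b (by omega)
  simp only [hs, Nat.add_sub_cancel_left]
  have hu : (Nat.unpair b).1 = Encodable.encode l := by simp [b]
  rw [hu, Encodable.encodek, Option.getD_some]
  have htl : t < (List.range (K + 1)).length := by simp; omega
  simp [l, List.getD_eq_getElem?_getD, Nat.lt_succ_of_le ht]

/-! ### Diagonal perturbations that send one given signal to another. -/

section Interpolation

variable {n : ℕ}

/-- The diagonal operator that samples its input at the times `τ t` with gains `κ t`. -/
def sampleOp (τ : ℕ → ℕ) (κ : ℕ → Fin n → ℝ) : Sys n where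
  toFun y := fun t i => κ t i * y (τ t) i
  map_add' x y := by
    funext t i
    simp [mul_add]
  map_smul' a x := by
    funext t i
    simp [mul_left_comm]

lemma sampleOp_apply (τ : ℕ → ℕ) (κ : ℕ → Fin n → ℝ) (y : Signal (Fin n → ℝ)) (t : ℕ)
    (i : Fin n) : sampleOp τ κ y t i = κ t i * y (τ t) i := rfl

lemma indNorm_entry_sampleOp_le {τ : ℕ → ℕ} (hτ : ∀ t, τ t ≤ t) {κ : ℕ → Fin n → ℝ}
    {r : Fin n → ℝ} (hκ : ∀ t i, |κ t i| ≤ r i) (i : Fin n) :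
    indNorm (entry (sampleOp τ κ) i i) ≤ ENNReal.ofReal (r i) := by
  refine indNorm_le fun T x b hb => ?_
  rw [entry_apply, sampleOp_apply, Pi.single_eq_same, norm_mul]
  exact mul_le_mul (hκ T i) (hb _ (hτ T)) (norm_nonneg _) ((abs_nonneg _).trans (hκ T i))

lemma sampleOp_mem_diagLTV {τ : ℕ → ℕ} (hτ : ∀ t, τ t ≤ t) {κ : ℕ → Fin n → ℝ}
    {r : Fin n → ℝ} (hκ : ∀ t i, |κ t i| ≤ r i) : sampleOp τ κ ∈ diagLTV n := by
  refine ⟨causal_of_congr fun T x y hxy => ?_, ?_, fun i j hij => ?_⟩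
  · funext i
    rw [sampleOp_apply, sampleOp_apply, hxy _ (hτ T)]
  · refine (indNorm_le (C := ∑ i, r i) fun T x b hb => ?_).trans_lt ENNReal.ofReal_lt_top
    have hb0 : 0 ≤ b := (norm_nonneg _).trans (hb 0 (Nat.zero_le _))
    have hr : ∀ i, 0 ≤ r i := fun i => (abs_nonneg _).trans (hκ 0 i)
    have hR : 0 ≤ ∑ i, r i := Finset.sum_nonneg fun i _ => hr i
    refine (pi_norm_le_iff_of_nonneg (by positivity)).2 fun i => ?_
    rw [sampleOp_apply, norm_mul]
    refine mul_le_mul ((hκ T i).trans ?_) ((norm_le_pi_norm _ i).trans (hb _ (hτ T)))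
      (norm_nonneg _) hR
    exact Finset.single_le_sum (f := r) (fun i _ => hr i) (Finset.mem_univ i)
  · refine LinearMap.ext fun x => funext fun t => ?_
    rw [entry_apply, sampleOp_apply, Pi.single_eq_of_ne hij, mul_zero]
    rfl

/-- The gain at time t is w t i / x (τ t) i. Where the denominator vanishes, the bound forces w t i
= 0, so the default value of the division does no harm. -/
lemma exists_diagLTV_map_eq {x w : Signal (Fin n → ℝ)} {τ : ℕ → ℕ} (hτ : ∀ t, τ t ≤ t)
    {r : Fin n → ℝ} (hr : ∀ i, 0 ≤ r i) (hw : ∀ t i, |w t i| ≤ r i * |x (τ t) i|) :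
    ∃ Δ ∈ diagLTV n, (∀ i, indNorm (entry Δ i i) ≤ ENNReal.ofReal (r i)) ∧ Δ x = w := by
  have hκ : ∀ t i, |w t i / x (τ t) i| ≤ r i := fun t i => by
    rw [abs_div]
    exact div_le_of_le_mul₀ (abs_nonneg _) (hr i) (hw t i)
  refine ⟨sampleOp τ fun t i => w t i / x (τ t) i, sampleOp_mem_diagLTV hτ hκ,
    indNorm_entry_sampleOp_le hτ hκ, ?_⟩
  funext t i
  rw [sampleOp_apply]
  by_cases h : x (τ t) i = 0
  · have := hw t i
    rw [h, abs_zero, mul_zero] at this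
    rw [h, mul_zero, abs_nonpos_iff.1 this]
  · exact div_mul_cancel₀ _ h

end Interpolation

/-! ### Signals that grow along a walk. -/

section Growth

variable {n : ℕ}

/-- The probing signal `v` on channel `j`, restricted to the `m`-th window of length `N + 1`. -/
def burst (N m : ℕ) (j : Fin n) (v : Signal ℝ) : Signal (Fin n → ℝ) := fun t =>
  if m * (N + 1) < t ∧ t ≤ (m + 1) * (N + 1) then Pi.single j (v (t - (m * (N + 1) + 1))) else 0

/-- The unit impulse on channel `i` at the end of the `m`-th window of length `N + 1`. -/
def impulse (N m : ℕ) (i : Fin n) : Signal (Fin n → ℝ) := fun t =>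
  if t = (m + 1) * (N + 1) then Pi.single i 1 else 0

/-- Up to the end of its window a burst coincides with the probe delayed by m (N + 1) + 1, so
causality and time invariance reduce the response there to that of the probe at time N. -/
lemma map_burst_apply {G : Sys n} (hG : Causal G) (hti : TimeInvariant G) (N m : ℕ)
    (i j : Fin n) (v : Signal ℝ) :
    G (burst N m j v) ((m + 1) * (N + 1)) i = entry G i j v N := by
  have h1 : G (burst N m j v) ((m + 1) * (N + 1)) =
      G (delay^[m * (N + 1) + 1] (fun s => Pi.single j (v s))) ((m + 1) * (N + 1)) := by
    refine hG.congr fun s hs => ?_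
    rw [delay_iterate_apply, burst]
    by_cases h : s < m * (N + 1) + 1
    · rw [if_pos h, if_neg (by omega)]
    · rw [if_neg h, if_pos (by omega)]
  have h2 : ¬ (m + 1) * (N + 1) < m * (N + 1) + 1 := by
    rw [add_mul]; omega
  have h3 : (m + 1) * (N + 1) - (m * (N + 1) + 1) = N := by
    rw [add_mul]; omega
  rw [h1, hti.iterate, delay_iterate_apply, if_neg h2, h3, entry_apply]

/-- The loop signal `u + G w` for a pair `(w, u)`. -/
def loopSignal (G : Sys n) (z : Signal (Fin n → ℝ) × Signal (Fin n → ℝ)) :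
    Signal (Fin n → ℝ) := z.2 + G z.1

/-- The sign of the loop signal at the end of the `m`-th window before the window is used. -/
def alignedSign (G : Sys n) (p : ℕ → Fin n) (N m : ℕ)
    (z : Signal (Fin n → ℝ) × Signal (Fin n → ℝ)) : ℝ :=
  if 0 ≤ loopSignal G z ((m + 1) * (N + 1)) (p (m + 1)) then 1 else -1

/-- Signals `(w, u)` that make the loop signal grow along the walk `p`: in the `m`-th window
channel `p m` drives channel `p (m + 1)` as hard as the gain bound `r` permits. -/
def growth (G : Sys n) (p : ℕ → Fin n) (r : Fin n → ℝ) (v : Fin n → Fin n → Signal ℝ) (N : ℕ) :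
    ℕ → Signal (Fin n → ℝ) × Signal (Fin n → ℝ)
  | 0 => 0
  | m + 1 =>
    let z := growth G p r v N m
    z + alignedSign G p N m z •
      ((r (p m) * |loopSignal G z (m * (N + 1)) (p m)|) • burst N m (p m) (v (p (m + 1)) (p m)),
        impulse N m (p (m + 1)))

lemma abs_alignedSign (G : Sys n) (p : ℕ → Fin n) (N m : ℕ)
    (z : Signal (Fin n → ℝ) × Signal (Fin n → ℝ)) : |alignedSign G p N m z| = 1 := by
  unfold alignedSign
  split_ifs <;> simp

variable (G : Sys n) (p : ℕ → Fin n) (r : Fin n → ℝ) (v : Fin n → Fin n → Signal ℝ) (N : ℕ)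

lemma growth_succ_fst (m t : ℕ) : (growth G p r v N (m + 1)).1 t = (growth G p r v N m).1 t +
    (alignedSign G p N m (growth G p r v N m) *
      (r (p m) * |loopSignal G (growth G p r v N m) (m * (N + 1)) (p m)|)) •
        burst N m (p m) (v (p (m + 1)) (p m)) t := by
  simp [growth, mul_smul]

lemma growth_succ_snd (m t : ℕ) : (growth G p r v N (m + 1)).2 t = (growth G p r v N m).2 t +
    alignedSign G p N m (growth G p r v N m) • impulse N m (p (m + 1)) t := by
  simp [growth]

lemma growth_succ_eq {m t : ℕ} (ht : t ≤ m * (N + 1)) :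
    (growth G p r v N (m + 1)).1 t = (growth G p r v N m).1 t ∧
      (growth G p r v N (m + 1)).2 t = (growth G p r v N m).2 t := by
  rw [growth_succ_fst, growth_succ_snd, burst, impulse, if_neg (by omega),
    if_neg (by rw [add_mul]; omega)]
  simp

lemma growth_eq_of_le {m k t : ℕ} (hmk : m ≤ k) (ht : t ≤ m * (N + 1)) :
    (growth G p r v N k).1 t = (growth G p r v N m).1 t ∧
      (growth G p r v N k).2 t = (growth G p r v N m).2 t := by
  induction k, hmk using Nat.le_induction with
  | base => exact ⟨rfl, rfl⟩
  | succ k hk ih =>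
    have := growth_succ_eq G p r v N (ht.trans (Nat.mul_le_mul_right _ hk))
    exact ⟨this.1.trans ih.1, this.2.trans ih.2⟩

lemma growth_eq_zero {m t : ℕ} (ht : m * (N + 1) < t) :
    (growth G p r v N m).1 t = 0 ∧ (growth G p r v N m).2 t = 0 := by
  induction m with
  | zero => exact ⟨rfl, rfl⟩
  | succ m ih =>
    have h := ih (lt_of_le_of_lt (Nat.mul_le_mul_right _ (Nat.le_succ m)) ht)
    rw [growth_succ_fst, growth_succ_snd, burst, impulse, h.1, h.2, if_neg (by omega),
      if_neg (by omega)]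
    simp

/-- The pointwise limit of `growth`. -/
def growthLim : Signal (Fin n → ℝ) × Signal (Fin n → ℝ) :=
  (fun t => (growth G p r v N t).1 t, fun t => (growth G p r v N t).2 t)

lemma growthLim_eq {m t : ℕ} (ht : t ≤ m * (N + 1)) :
    (growthLim G p r v N).1 t = (growth G p r v N m).1 t ∧
      (growthLim G p r v N).2 t = (growth G p r v N m).2 t := by
  rcases le_total m t with h | h
  · exact growth_eq_of_le G p r v N h ht
  · have := growth_eq_of_le G p r v N h (Nat.le_mul_of_pos_right t (Nat.succ_pos N))
    exact ⟨this.1.symm, this.2.symm⟩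

variable {G}

lemma loopSignal_growthLim (hG : Causal G) {m t : ℕ} (ht : t ≤ m * (N + 1)) :
    loopSignal G (growthLim G p r v N) t = loopSignal G (growth G p r v N m) t := by
  unfold loopSignal
  rw [Pi.add_apply, Pi.add_apply, (growthLim_eq G p r v N ht).2,
    hG.congr fun s hs => (growthLim_eq G p r v N (hs.trans ht)).1]

variable {p r v}

/-- The impulses sit at distinct times, the window ends, and therefore never add up. -/
lemma abs_growthLim_snd_le (t : ℕ) (i : Fin n) : |(growthLim G p r v N).2 t i| ≤ 1 := by
  have h : ∀ m, |(growth G p r v N m).2 t i| ≤ 1 := by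
    intro m
    induction m with
    | zero => simp [growth]
    | succ m ih =>
      rw [growth_succ_snd, impulse]
      split_ifs with ht
      · rw [(growth_eq_zero G p r v N (m := m) (by rw [ht, add_mul]; omega)).2, zero_add,
          Pi.smul_apply, smul_eq_mul, abs_mul, abs_alignedSign, one_mul]
        by_cases hi : i = p (m + 1)
        · rw [hi, Pi.single_eq_same, abs_one]
        · rw [Pi.single_eq_of_ne hi, abs_zero]
          exact zero_le_one
      · simpa using ih
  exact h t

/-- This is the hypothesis of `exists_diagLTV_map_eq`. Window m consists of the t with m (N + 1) < t
≤ (m + 1)(N + 1), so for t > 0 the sampling time (t - 1) / (N + 1) * (N + 1) is the last instant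
before the window containing t. There w is a probe of size at most 1, scaled up to sign by r times
the sampled loop signal. -/
lemma abs_growthLim_fst_le (hG : Causal G) (hr : ∀ i, 0 ≤ r i)
    (hv : ∀ i j, ∀ t ≤ N, |v i j t| ≤ 1) (t : ℕ) (i : Fin n) :
    |(growthLim G p r v N).1 t i| ≤
      r i * |loopSignal G (growthLim G p r v N) ((t - 1) / (N + 1) * (N + 1)) i| := by
  rcases Nat.eq_zero_or_pos t with rfl | ht
  · have h0 : (growthLim G p r v N).1 0 = 0 := rfl
    rw [h0, Pi.zero_apply, abs_zero]
    exact mul_nonneg (hr i) (abs_nonneg _)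
  · obtain ⟨m, hm⟩ : ∃ m, (t - 1) / (N + 1) = m := ⟨_, rfl⟩
    have h1 := Nat.div_mul_le_self (t - 1) (N + 1)
    have h2 := Nat.lt_div_mul_add (a := t - 1) (b := N + 1) (Nat.succ_pos N)
    rw [hm] at h1 h2 ⊢
    replace h1 : m * (N + 1) < t := by omega
    replace h2 : t ≤ (m + 1) * (N + 1) := by rw [add_mul]; omega
    rw [(growthLim_eq G p r v N h2).1, growth_succ_fst, (growth_eq_zero G p r v N h1).1, zero_add,
      burst, if_pos ⟨h1, h2⟩, loopSignal_growthLim p r v N hG le_rfl, Pi.smul_apply, smul_eq_mul,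
      abs_mul, abs_mul, abs_alignedSign, one_mul, abs_mul, abs_abs, abs_of_nonneg (hr _)]
    by_cases hi : i = p m
    · rw [hi, Pi.single_eq_same]
      refine mul_le_of_le_one_right (mul_nonneg (hr _) (abs_nonneg _)) (hv _ _ _ ?_)
      rw [add_mul] at h2; omega
    · rw [Pi.single_eq_of_ne hi, abs_zero, mul_zero]
      exact mul_nonneg (hr i) (abs_nonneg _)

/-- The burst and the impulse are given the sign of what earlier windows already contribute at this
instant. Nothing cancels, so the residual response of the past can be discarded from the lower
bound. -/
lemma le_abs_loopSignal_growthLim (hG : Causal G) (hti : TimeInvariant G) (hr : ∀ i, 0 ≤ r i)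
    {c : Fin n → Fin n → ℝ} (hc : ∀ i j, c i j ≤ entry G i j (v i j) N)
    (hc0 : ∀ i j, 0 ≤ c i j) (m : ℕ) :
    1 + c (p (m + 1)) (p m) * r (p m) *
        |loopSignal G (growthLim G p r v N) (m * (N + 1)) (p m)| ≤
      |loopSignal G (growthLim G p r v N) ((m + 1) * (N + 1)) (p (m + 1))| := by
  rw [loopSignal_growthLim p r v N hG le_rfl, loopSignal_growthLim p r v N hG le_rfl]
  set z := growth G p r v N m with hz
  set y := |loopSignal G z (m * (N + 1)) (p m)| with hy
  set s := alignedSign G p N m z with hs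
  set g := entry G (p (m + 1)) (p m) (v (p (m + 1)) (p m)) N with hg
  have h1 : loopSignal G (growth G p r v N (m + 1)) ((m + 1) * (N + 1)) (p (m + 1)) =
      loopSignal G z ((m + 1) * (N + 1)) (p (m + 1)) + s * (1 + r (p m) * y * g) := by
    have h2 : growth G p r v N (m + 1) = z + s • ((r (p m) * y) •
        burst N m (p m) (v (p (m + 1)) (p m)), impulse N m (p (m + 1))) := rfl
    rw [h2, hg, ← map_burst_apply hG hti]
    simp only [loopSignal, Prod.fst_add, Prod.snd_add, Prod.smul_fst, Prod.smul_snd, map_add,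
      map_smul, Pi.add_apply, Pi.smul_apply, smul_eq_mul, impulse, if_true, Pi.single_eq_same]
    ring
  have hyr : 0 ≤ r (p m) * y := mul_nonneg (hr _) (abs_nonneg _)
  have hcg : c (p (m + 1)) (p m) * r (p m) * y ≤ r (p m) * y * g := by
    have := mul_le_mul_of_nonneg_left (hc (p (m + 1)) (p m)) hyr
    linarith
  have hpos : 0 ≤ r (p m) * y * g := mul_nonneg hyr ((hc0 _ _).trans (hc _ _))
  rw [h1, hs]
  unfold alignedSign
  split_ifs with h
  · rw [abs_of_nonneg (by linarith)]
    linarith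
  · rw [abs_of_neg (by linarith)]
    linarith

end Growth

/-! ### Construction of destabilizing perturbations. -/

section Destabilize

variable {n : ℕ}

/-- The induced norm is a supremum that need not be attained, hence the strict inequality; the sign
of the probe is adjusted at the end. -/
lemma exists_probe {G : Sys n} (i j : Fin n) {c : ℝ} (hc0 : 0 ≤ c)
    (hc : c = 0 ∨ c < magMatrix G i j) :
    ∃ (N : ℕ) (v : Signal ℝ), (∀ t ≤ N, |v t| ≤ 1) ∧ c ≤ entry G i j v N := by
  rcases hc with rfl | hc
  · exact ⟨0, 0, by simp, by simp⟩
  · obtain ⟨N, v, hv, h⟩ := exists_lt_norm_apply hc0 hc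
    rcases le_total 0 (entry G i j v N) with h0 | h0
    · exact ⟨N, v, hv, by rw [Real.norm_of_nonneg h0] at h; exact h.le⟩
    · refine ⟨N, -v, fun t ht => by simpa using hv t ht, ?_⟩
      rw [Real.norm_of_nonpos h0] at h
      rw [map_neg]
      exact h.le

/-- Delaying the individual probes makes all of them act at one common time N, so that windows of a
single length suffice. -/
lemma exists_uniform_probe {G : Sys n} (hti : TimeInvariant G) {c : Fin n → Fin n → ℝ}
    (hc0 : ∀ i j, 0 ≤ c i j) (hc : ∀ i j, c i j = 0 ∨ c i j < magMatrix G i j) :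
    ∃ (N : ℕ) (v : Fin n → Fin n → Signal ℝ), (∀ i j, ∀ t ≤ N, |v i j t| ≤ 1) ∧
      ∀ i j, c i j ≤ entry G i j (v i j) N := by
  choose N v hv h using fun i j => exists_probe i j (hc0 i j) (hc i j)
  let M := ∑ i, ∑ j, N i j
  have hM : ∀ i j, N i j ≤ M := fun i j =>
    (Finset.single_le_sum (f := fun j => N i j) (fun _ _ => Nat.zero_le _)
      (Finset.mem_univ j)).trans (Finset.single_le_sum (f := fun i => ∑ j, N i j)
      (fun _ _ => Nat.zero_le _) (Finset.mem_univ i))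
  refine ⟨M, fun i j => delay^[M - N i j] (v i j), fun i j t ht => ?_, fun i j => ?_⟩
  · simp only [delay_iterate_apply]
    split_ifs with h1
    · simp
    · exact hv i j _ (by have := hM i j; omega)
  · have h1 : (fun s => Pi.single j (delay^[M - N i j] (v i j) s) : Signal (Fin n → ℝ)) =
        delay^[M - N i j] (fun s => Pi.single j (v i j s)) := by
      funext s
      rw [delay_iterate_apply, delay_iterate_apply]
      split_ifs
      · exact Pi.single_zero j
      · rfl
    have h2 := hM i j
    rw [entry_apply, h1, hti.iterate, delay_iterate_apply, if_neg (by omega),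
      Nat.sub_sub_self h2]
    exact h i j

/-- If the gains `c i j * r j` have unbounded products along walks, then some diagonal perturbation
with entries of norm at most `r j` destabilizes the loop. -/
theorem exists_not_loopStable (hn : 1 ≤ n) {G : Sys n} (hG : Causal G) (hti : TimeInvariant G)
    {c : Fin n → Fin n → ℝ} (hc0 : ∀ i j, 0 ≤ c i j)
    (hc : ∀ i j, c i j = 0 ∨ c i j < magMatrix G i j) {r : Fin n → ℝ} (hr : ∀ i, 0 ≤ r i)
    (hunb : ∀ C, ∃ (f : ℕ → Fin n) (K : ℕ),
      C < ∏ m ∈ Finset.range K, c (f (m + 1)) (f m) * r (f m)) :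
    ∃ Δ ∈ diagLTV n, (∀ i, indNorm (entry Δ i i) ≤ ENNReal.ofReal (r i)) ∧ ¬ LoopStable G Δ := by
  have : Nonempty (Fin n) := ⟨⟨0, hn⟩⟩
  obtain ⟨N, v, hv, hcv⟩ := exists_uniform_probe hti hc0 hc
  obtain ⟨p, hp⟩ := exists_universal_sequence (Fin n)
  set z := growthLim G p r v N with hz
  set x := loopSignal G z with hx
  obtain ⟨Δ, hΔ, hΔr, hΔx⟩ := exists_diagLTV_map_eq
    (fun t => (Nat.div_mul_le_self (t - 1) (N + 1)).trans (Nat.sub_le t 1)) hr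
    (abs_growthLim_fst_le N hG hr hv (p := p))
  refine ⟨Δ, hΔ, hΔr, ?_⟩
  rintro ⟨K, -, hK, -, hKl⟩
  -- Since Δ x = w, the loop equation reads (I - GΔ) x = u, and a left inverse recovers x from u.
  have hKx : K z.2 = x := by
    have h1 := LinearMap.congr_fun hKl x
    have h2 : (LinearMap.id - G ∘ₗ Δ : Sys n) x = z.2 := by
      change x - G (Δ x) = z.2
      rw [hΔx, hx, loopSignal, add_sub_cancel_right]
    rw [LinearMap.comp_apply, h2] at h1
    exact h1
  have hxb : ∀ t i, |x t i| ≤ (indNorm K).toReal := fun t i => by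
    rw [← hKx, ← mul_one (indNorm K).toReal]
    refine (norm_le_pi_norm (K z.2 t) i).trans (hK.norm_apply_le fun s _ => ?_)
    exact (pi_norm_le_iff_of_nonneg zero_le_one).2 fun i => abs_growthLim_snd_le N s i
  have hstep := le_abs_loopSignal_growthLim N hG hti hr hcv hc0 (p := p)
  obtain ⟨f, k, hfk⟩ := hunb (indNorm K).toReal
  obtain ⟨q, hq, hpq⟩ := hp f k
  have hcr : ∀ i j, 0 ≤ c i j * r j := fun i j => mul_nonneg (hc0 i j) (hr j)
  have key : ∀ m ≤ k, ∏ m ∈ Finset.range m, c (f (m + 1)) (f m) * r (f m) ≤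
      |x ((q + m) * (N + 1)) (p (q + m))| := by
    intro m
    induction m with
    | zero =>
      intro _
      -- As q ≥ 1, a window ends at time q (N + 1), and its impulse makes the loop signal at least 1
      -- there. The word thus starts from 1, whatever happened before.
      obtain ⟨q, rfl⟩ := Nat.exists_eq_add_of_le' hq
      refine le_trans ?_ (hstep q)
      rw [Finset.prod_range_zero]
      exact le_add_of_nonneg_right (mul_nonneg (hcr _ _) (abs_nonneg _))
    | succ m ih =>
      intro hm
      have h1 := hstep (q + m)
      have h2 := hpq m (by omega)
      have h3 : p (q + m + 1) = f (m + 1) := hpq (m + 1) hm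
      have h4 := mul_le_mul_of_nonneg_left (ih (by omega)) (hcr (f (m + 1)) (f m))
      rw [Finset.prod_range_succ, mul_comm, ← add_assoc]
      rw [h2] at h1 h4
      rw [h3] at h1 ⊢
      linarith
  exact absurd ((key k le_rfl).trans (hxb _ _)) (not_le.2 hfk)

end Destabilize

/-- A nonnegative matrix either admits diagonal potentials, or has unbounded products along walks. -/
lemma exists_potential_or_unbounded {n : ℕ} {A : Fin n → Fin n → ℝ} (hA : ∀ i j, 0 ≤ A i j) :
    (∃ d : Fin n → ℝ, (∀ i, 0 < d i) ∧ ∀ i j, d i * A i j ≤ d j) ∨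
      ∀ C, ∃ (f : ℕ → Fin n) (K : ℕ), C < ∏ m ∈ Finset.range K, A (f (m + 1)) (f m) := by
  rw [or_iff_not_imp_right]
  intro h
  push Not at h
  obtain ⟨C, hC⟩ := h
  -- The potential at j is the supremum of the products over walks that start at j; the empty walk
  -- makes it at least 1.
  let S : Fin n → Set ℝ := fun j =>
    {y | ∃ (f : ℕ → Fin n) (K : ℕ), f 0 = j ∧ y = ∏ m ∈ Finset.range K, A (f (m + 1)) (f m)}
  have hS : ∀ j, BddAbove (S j) := fun j => ⟨C, by rintro _ ⟨f, K, -, rfl⟩; exact hC f K⟩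
  have h1 : ∀ j, 1 ≤ sSup (S j) := fun j => le_csSup (hS j) ⟨fun _ => j, 0, rfl, by simp⟩
  refine ⟨fun j => sSup (S j), fun j => zero_lt_one.trans_le (h1 j), fun i j => ?_⟩
  rcases (hA i j).eq_or_lt with h0 | h0
  · rw [← h0, mul_zero]
    exact zero_le_one.trans (h1 j)
  · rw [← le_div_iff₀ h0]
    refine csSup_le ⟨1, fun _ => i, 0, rfl, by simp⟩ ?_
    rintro _ ⟨f, K, rfl, rfl⟩
    rw [le_div_iff₀ h0]
    -- Prepending j to a walk from i multiplies its product by A i j.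
    refine le_csSup (hS j) ⟨fun m => Nat.casesOn m j f, K + 1, rfl, ?_⟩
    rw [Finset.prod_range_succ']
    rfl

/-! ### Potentials and determinants on an n-cycle. -/

section Cycle

variable {n : ℕ} {σ : Equiv.Perm (Fin n)}

/-- A multiplicative cocycle with product one on an `n`-cycle is a coboundary. -/
lemma exists_potential_of_isCycleOn (hn : 1 ≤ n) (hσ : σ.IsCycleOn Set.univ) {b : Fin n → ℝ}
    (hb : ∏ i, b i = 1) (hb0 : ∀ i, 0 ≤ b i) :
    ∃ v : Fin n → ℝ, (∀ i, 0 < v i) ∧ ∀ i, v (σ i) = b i * v i := by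
  have hpos : ∀ i, 0 < b i := fun i => (hb0 i).lt_of_ne' fun h =>
    one_ne_zero (hb.symm.trans (Finset.prod_eq_zero (Finset.mem_univ i) h))
  have hσ' : σ.IsCycleOn (Finset.univ : Finset (Fin n)) := by simpa using hσ
  let a : Fin n := ⟨0, hn⟩
  have hex : ∀ j, ∃ k < n, (σ ^ k) a = j := fun j => by
    simpa using hσ'.exists_pow_eq (Finset.mem_univ a) (Finset.mem_univ j)
  have hmod : ∀ k l : ℕ, (σ ^ k) a = (σ ^ l) a ↔ k ≡ l [MOD n] := fun k l => by
    simpa using hσ'.pow_apply_eq_pow_apply (Finset.mem_univ a) (m := k) (n := l)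
  choose k hk hka using hex
  have hall : ∏ l ∈ Finset.range n, b ((σ ^ l) a) = 1 := by
    rw [← hb]
    refine Finset.prod_bij (fun l _ => (σ ^ l) a) (fun _ _ => Finset.mem_univ _) ?_ ?_
      (fun _ _ => rfl)
    · intro l hl l' hl' h
      exact ((hmod l l').1 h).eq_of_lt_of_lt (Finset.mem_range.1 hl) (Finset.mem_range.1 hl')
    · intro j _
      exact ⟨k j, Finset.mem_range.2 (hk j), hka j⟩
  refine ⟨fun j => ∏ l ∈ Finset.range (k j), b ((σ ^ l) a),
    fun j => Finset.prod_pos fun l _ => hpos _, fun j => ?_⟩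
  have h1 : (σ ^ (k j + 1)) a = σ j := by
    rw [pow_succ', Equiv.Perm.mul_apply, hka]
  have h2 : b j * ∏ l ∈ Finset.range (k j), b ((σ ^ l) a) =
      ∏ l ∈ Finset.range (k j + 1), b ((σ ^ l) a) := by
    rw [Finset.prod_range_succ, hka, mul_comm]
  change ∏ l ∈ Finset.range (k (σ j)), b ((σ ^ l) a) = _
  rw [h2]
  rcases (Nat.succ_le_of_lt (hk j)).lt_or_eq with h | h
  · rw [((hmod _ _).1 ((hka (σ j)).trans h1.symm)).eq_of_lt_of_lt (hk _) h]
  -- Wrap-around: here j is the last point of the orbit and σ j = a carries the empty product.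
  -- Consistency is exactly the hypothesis that the full product is 1.
  · have h3 : (σ ^ n) a = σ j := by rw [← h1]; congr 2; exact h.symm
    have h4 : k (σ j) ≡ 0 [MOD n] := by
      have h5 := (hmod _ _).1 ((hka (σ j)).trans h3.symm)
      exact h5.trans (by simp [Nat.ModEq])
    rw [h4.eq_of_lt_of_lt (hk _) hn, Finset.prod_range_zero,
      show k j + 1 = n from h, hall]

/-- A kernel vector satisfies v_i = A_{i,σ i} v_{σ i}, and multiplying around the cycle forces
product 1. Conversely, a potential for the inverse entries is a kernel vector. -/
lemma det_one_sub_eq_zero_iff_of_isCycleOn (hn : 1 ≤ n) (hσ : σ.IsCycleOn Set.univ)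
    {A : Matrix (Fin n) (Fin n) ℝ} (hA0 : ∀ i, 0 ≤ A i (σ i))
    (hA : ∀ i j, j ≠ σ i → A i j = 0) : (1 - A).det = 0 ↔ ∏ i, A i (σ i) = 1 := by
  have hmul : ∀ (v : Fin n → ℝ) i, (1 - A).mulVec v i = v i - A i (σ i) * v (σ i) := by
    intro v i
    rw [Matrix.sub_mulVec, Matrix.one_mulVec, Pi.sub_apply, Matrix.mulVec, dotProduct,
      Finset.sum_eq_single (σ i) (fun j _ hj => by rw [hA i j hj, zero_mul]) (by simp)]
  rw [← Matrix.exists_mulVec_eq_zero_iff]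
  constructor
  · rintro ⟨v, hv, h⟩
    have hv' : ∀ i, v i = A i (σ i) * v (σ i) := fun i => by
      have := congrFun h i
      rw [hmul, Pi.zero_apply] at this
      linarith
    -- A zero entry would propagate backwards along the cycle and annihilate v.
    have hne : ∀ i, v i ≠ 0 := by
      intro i hi
      refine hv (funext fun j => ?_)
      obtain ⟨k, hk⟩ := hσ.exists_pow_eq' Set.finite_univ (Set.mem_univ j) (Set.mem_univ i)
      have hback : ∀ k : ℕ, ∀ j, v ((σ ^ k) j) = 0 → v j = 0 := by
        intro k
        induction k with
        | zero => intro j h; exact h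
        | succ k ih =>
          intro j h
          rw [pow_succ, Equiv.Perm.mul_apply] at h
          rw [hv' j, ih _ h, mul_zero]
      exact hback k j (by rw [hk, hi])
    have h1 : ∏ i, v i = (∏ i, A i (σ i)) * ∏ i, v i := by
      conv_lhs => rw [Finset.prod_congr rfl fun i _ => hv' i]
      rw [Finset.prod_mul_distrib, Equiv.prod_comp σ v]
    exact (mul_eq_right₀ (Finset.prod_ne_zero_iff.2 fun i _ => hne i)).1 h1.symm
  · intro h
    obtain ⟨v, hv, hvs⟩ := exists_potential_of_isCycleOn hn hσ (b := fun i => (A i (σ i))⁻¹)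
      (by rw [Finset.prod_inv_distrib, h, inv_one]) fun i => inv_nonneg.2 (hA0 i)
    refine ⟨v, fun h0 => (hv ⟨0, hn⟩).ne' (congrFun h0 _), funext fun i => ?_⟩
    have hne : A i (σ i) ≠ 0 := fun h0 =>
      one_ne_zero (h.symm.trans (Finset.prod_eq_zero (Finset.mem_univ i) h0))
    rw [hmul, hvs, mul_inv_cancel_left₀ hne, sub_self, Pi.zero_apply]

end Cycle

lemma prod_le_mean_pow {n : ℕ} (hn : 1 ≤ n) {r : Fin n → ℝ} (hr : ∀ i, 0 ≤ r i) :
    ∏ i, r i ≤ ((∑ i, r i) / n) ^ n := by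
  have h := Real.geom_mean_le_arith_mean Finset.univ (fun _ : Fin n => (1 : ℝ)) r
    (fun _ _ => zero_le_one) (by simp; omega) fun i _ => hr i
  simp only [Real.rpow_one, one_mul, Finset.sum_const, Finset.card_univ, Fintype.card_fin,
    nsmul_eq_mul, mul_one] at h
  have hp := Finset.prod_nonneg (s := Finset.univ) fun i _ => hr i
  have h2 := pow_le_pow_left₀ (Real.rpow_nonneg hp _) h n
  rwa [Real.rpow_inv_natCast_pow hp (by omega)] at h2

/-! ### Bounds for ν and ν̄. -/

section Bounds

variable {n : ℕ}

/-- Test on a unit vector, whose image is a column. With `oneInfNorm_le` this identifies the norm as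
the largest absolute entry. -/
lemma enorm_apply_le_oneInfNorm (A : Matrix (Fin n) (Fin n) ℝ) (i j : Fin n) :
    ‖A i j‖ₑ ≤ oneInfNorm A := by
  have h1 := le_iSup (fun x : Fin n → ℝ => ‖A.mulVec x‖ₑ / ∑ j, ‖x j‖ₑ) (Pi.single j 1)
  have h2 : ∑ k, ‖(Pi.single j 1 : Fin n → ℝ) k‖ₑ = 1 := by
    rw [Finset.sum_eq_single j (fun k _ hk => by rw [Pi.single_eq_of_ne hk, enorm_zero])
      (by simp), Pi.single_eq_same, enorm_one]
  simp only [h2, div_one, Matrix.mulVec_single_one] at h1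
  refine le_trans ?_ h1
  rw [← ofReal_norm, ← ofReal_norm]
  exact ENNReal.ofReal_le_ofReal (norm_le_pi_norm (A.col j) i)

lemma oneInfNorm_le {A : Matrix (Fin n) (Fin n) ℝ} {m : ℝ} (hm : 0 ≤ m)
    (h : ∀ i j, |A i j| ≤ m) : oneInfNorm A ≤ ENNReal.ofReal m := by
  refine iSup_le fun x => ENNReal.div_le_of_le_mul ?_
  have h1 : ∑ j, ‖x j‖ₑ = ENNReal.ofReal (∑ j, |x j|) := by
    rw [ENNReal.ofReal_sum_of_nonneg fun j _ => abs_nonneg _]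
    exact Finset.sum_congr rfl fun j _ => (ofReal_norm (x j)).symm
  rw [h1, ← ENNReal.ofReal_mul hm, ← ofReal_norm]
  refine ENNReal.ofReal_le_ofReal ((pi_norm_le_iff_of_nonneg (by positivity)).2 fun i => ?_)
  rw [Finset.mul_sum, Matrix.mulVec, dotProduct]
  refine (Finset.abs_sum_le_sum_abs (fun j => A i j * x j) _).trans
    (Finset.sum_le_sum fun j _ => ?_)
  rw [abs_mul]
  exact mul_le_mul_of_nonneg_right (h i j) (abs_nonneg _)

lemma oneInfNorm_ne_top (A : Matrix (Fin n) (Fin n) ℝ) : oneInfNorm A ≠ ∞ := by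
  refine ne_top_of_le_ne_top ENNReal.ofReal_ne_top
    (oneInfNorm_le (m := ∑ i, ∑ j, |A i j|) (by positivity) fun i j => ?_)
  exact (Finset.single_le_sum (f := fun j => |A i j|) (fun j _ => abs_nonneg (A i j))
    (Finset.mem_univ j)).trans (Finset.single_le_sum (f := fun i => ∑ j, |A i j|)
    (fun i _ => Finset.sum_nonneg fun j _ => abs_nonneg (A i j)) (Finset.mem_univ i))

lemma abs_apply_le_oneInfNorm (A : Matrix (Fin n) (Fin n) ℝ) (i j : Fin n) :
    |A i j| ≤ (oneInfNorm A).toReal := by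
  have := ENNReal.toReal_mono (oneInfNorm_ne_top A) (enorm_apply_le_oneInfNorm A i j)
  rwa [toReal_enorm] at this

lemma diagConj_apply (d : Fin n → ℝ) (A : Matrix (Fin n) (Fin n) ℝ) (i j : Fin n) :
    diagConj d A i j = d i * A i j * (d j)⁻¹ := by
  rw [diagConj, Matrix.mul_diagonal, Matrix.diagonal_mul]

lemma nuBar_le {G : Sys n} {d : Fin n → ℝ} (hd : ∀ i, 0 < d i) {m : ℝ} (hm : 0 ≤ m)
    (h : ∀ i j, d i * magMatrix G i j ≤ m * d j) : nuBar G ≤ ENNReal.ofReal m := by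
  refine iInf₂_le_of_le d hd (oneInfNorm_le hm fun i j => ?_)
  rw [diagConj_apply, ← div_eq_mul_inv, abs_of_nonneg
    (div_nonneg (mul_nonneg (hd i).le (magMatrix_nonneg G i j)) (hd j).le), div_le_iff₀ (hd j)]
  exact h i j

lemma nuBar_lt_top (G : Sys n) : nuBar G < ∞ :=
  (iInf₂_le (fun _ => (1 : ℝ)) fun _ => one_pos).trans_lt (oneInfNorm_ne_top _).lt_top

lemma nu_le {G : Sys n} {m : ℝ} (hm : 0 ≤ m)
    (h : ∀ Δ ∈ diagLTV n, ¬ LoopStable G Δ → 1 ≤ m * ∑ i, magMatrix Δ i i) :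
    nu G ≤ ENNReal.ofReal m := by
  rw [nu, one_div, ENNReal.inv_le_iff_inv_le]
  refine le_sInf ?_
  rintro _ ⟨Δ, hΔ, hns, rfl⟩
  have h1 : ∑ i, indNorm (entry Δ i i) = ENNReal.ofReal (∑ i, magMatrix Δ i i) := by
    rw [ENNReal.ofReal_sum_of_nonneg fun i _ => magMatrix_nonneg Δ i i]
    exact Finset.sum_congr rfl fun i _ => (ENNReal.ofReal_toReal (hΔ.2.1.entry i i).ne).symm
  have h2 := h Δ hΔ hns
  have hm' : 0 < m := hm.lt_of_ne fun h0 => by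
    rw [← h0, zero_mul] at h2
    exact absurd h2 (by norm_num)
  rw [h1, ← ENNReal.ofReal_inv_of_pos hm']
  exact ENNReal.ofReal_le_ofReal ((inv_le_iff_one_le_mul₀' hm').2 h2)

lemma le_nu {G Δ : Sys n} (hΔ : Δ ∈ diagLTV n) (hns : ¬ LoopStable G Δ) {r : Fin n → ℝ}
    (hr : ∀ i, 0 ≤ r i) (hΔr : ∀ i, indNorm (entry Δ i i) ≤ ENNReal.ofReal (r i)) {m : ℝ}
    (hm : 0 < m) (hrm : ∑ i, r i ≤ m⁻¹) : ENNReal.ofReal m ≤ nu G := by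
  rw [nu, one_div, ENNReal.le_inv_iff_le_inv, ← ENNReal.ofReal_inv_of_pos hm]
  refine le_trans (sInf_le ⟨Δ, hΔ, hns, rfl⟩) ((Finset.sum_le_sum fun i _ => hΔr i).trans ?_)
  rw [← ENNReal.ofReal_sum_of_nonneg fun i _ => hr i]
  exact ENNReal.ofReal_le_ofReal hrm

lemma exists_real_btwn_btwn {a b : ℝ≥0∞} (h : a < b) :
    ∃ μ μ' : ℝ, 0 < μ ∧ μ < μ' ∧ a < ENNReal.ofReal μ ∧ ENNReal.ofReal μ' < b := by
  obtain ⟨x, hx1, hx2⟩ := ENNReal.lt_iff_exists_nnreal_btwn.1 h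
  obtain ⟨y, hy1, hy2⟩ := ENNReal.lt_iff_exists_nnreal_btwn.1 hx2
  refine ⟨x, y, ?_, by exact_mod_cast hy1, by simpa using hx1, by simpa using hy2⟩
  have : (0 : ℝ≥0∞) < x := bot_le.trans_lt hx1
  exact_mod_cast this

lemma nu_le_nuBar {G : Sys n} (hG : Stable G) : nu G ≤ nuBar G := by
  refine le_iInf₂ fun d hd => ?_
  set m := (oneInfNorm (diagConj d (magMatrix G))).toReal with hmdef
  have hm : 0 ≤ m := ENNReal.toReal_nonneg
  rw [← ENNReal.ofReal_toReal (oneInfNorm_ne_top (diagConj d (magMatrix G)))]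
  refine nu_le hm fun Δ hΔ hns => not_lt.1 fun hlt => hns ?_
  refine loopStable_of_weights hG hΔ hd
    (mul_nonneg hm (Finset.sum_nonneg fun i _ => magMatrix_nonneg Δ i i)) hlt fun i => ?_
  rw [Finset.mul_sum]
  refine Finset.sum_le_sum fun j _ => ?_
  have h1 := (le_abs_self _).trans (abs_apply_le_oneInfNorm (diagConj d (magMatrix G)) i j)
  rw [diagConj_apply] at h1
  refine le_trans (le_of_eq ?_) (mul_le_mul_of_nonneg_right h1 (magMatrix_nonneg Δ j j))
  ring

/-- If n ν < μ < μ' < ν̄, apply the dichotomy to M / μ', factored as gains c = (μ/μ') M and r = 1/μ.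
The ratio μ/μ' < 1 puts c strictly below M at nonzero entries, as the probes require. Potentials
would give ν̄ ≤ μ', unbounded walks ν ≥ μ/n. -/
lemma nuBar_le_mul_nu (hn : 1 ≤ n) {G : Sys n} (hG : Causal G) (hti : TimeInvariant G) :
    nuBar G ≤ n * nu G := by
  by_contra! hlt
  obtain ⟨μ, μ', hμ, hμμ', h1, h2⟩ := exists_real_btwn_btwn hlt
  have hμ' : 0 < μ' := hμ.trans hμμ'
  have hn0 : (0 : ℝ) < n := by exact_mod_cast hn
  have hc0 : ∀ i j, 0 ≤ μ / μ' * magMatrix G i j := fun i j =>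
    mul_nonneg (by positivity) (magMatrix_nonneg G i j)
  have hr : ∀ _ : Fin n, 0 ≤ μ⁻¹ := fun _ => by positivity
  rcases exists_potential_or_unbounded
    (A := fun i j => μ / μ' * magMatrix G i j * μ⁻¹) (fun i j => mul_nonneg (hc0 i j) (hr j))
    with ⟨d, hd, hdA⟩ | hunb
  · refine absurd (nuBar_le hd hμ'.le fun i j => ?_) (not_le.2 h2)
    have h3 := hdA i j
    have h4 : d i * (μ / μ' * magMatrix G i j * μ⁻¹) = d i * magMatrix G i j / μ' := by
      field_simp
    rw [h4, div_le_iff₀ hμ'] at h3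
    linarith
  · obtain ⟨Δ, hΔ, hΔr, hns⟩ := exists_not_loopStable hn hG hti hc0 (fun i j => by
      rcases (magMatrix_nonneg G i j).eq_or_lt with h | h
      · exact Or.inl (by rw [← h, mul_zero])
      · exact Or.inr (mul_lt_of_lt_one_left h ((div_lt_one hμ').2 hμμ'))) hr hunb
    have h3 : ENNReal.ofReal (μ / n) ≤ nu G := le_nu hΔ hns hr hΔr (by positivity) (by
      rw [Finset.sum_const, Finset.card_univ, Fintype.card_fin, nsmul_eq_mul, inv_div,
        div_eq_mul_inv])
    have h4 : (n : ℝ≥0∞) * ENNReal.ofReal (μ / n) = ENNReal.ofReal μ := by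
      rw [← ENNReal.ofReal_natCast, ← ENNReal.ofReal_mul hn0.le, mul_div_cancel₀ _ hn0.ne']
    exact absurd (h4 ▸ mul_le_mul_right h3 (n : ℝ≥0∞)) (not_le.2 h1)

/-- Only the self-loop at k is used: the constant walk has products (μ'/μ)ᴷ, and a single nonzero
δ_k of norm at most 1/μ pays for it. -/
lemma diag_le_nu (hn : 1 ≤ n) {G : Sys n} (hG : Causal G) (hti : TimeInvariant G) (k : Fin n) :
    ENNReal.ofReal (magMatrix G k k) ≤ nu G := by
  by_contra! hlt
  obtain ⟨μ, μ', hμ, hμμ', h1, h2⟩ := exists_real_btwn_btwn hlt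
  have hμ' : 0 < μ' := hμ.trans hμμ'
  have h3 : μ' < magMatrix G k k := (ENNReal.ofReal_lt_ofReal_iff'.1 h2).1
  let c : Fin n → Fin n → ℝ := fun i j => if i = k ∧ j = k then μ' else 0
  let r : Fin n → ℝ := Pi.single k μ⁻¹
  have hr : ∀ i, 0 ≤ r i := fun i => by
    by_cases hi : i = k
    · rw [hi]; simp only [r, Pi.single_eq_same]; positivity
    · simp only [r, Pi.single_eq_of_ne hi]; exact le_rfl
  obtain ⟨Δ, hΔ, hΔr, hns⟩ := exists_not_loopStable hn hG hti (c := c) (r := r)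
    (fun i j => by simp only [c]; split_ifs; exacts [hμ'.le, le_rfl])
    (fun i j => by
      simp only [c]
      split_ifs with h
      · rw [h.1, h.2]; exact Or.inr h3
      · exact Or.inl rfl) hr fun C => by
        obtain ⟨K, hK⟩ := pow_unbounded_of_one_lt C
          (show 1 < μ' * μ⁻¹ from (one_lt_div hμ).2 hμμ')
        exact ⟨fun _ => k, K, by simpa [c, r] using hK⟩
  refine absurd (le_nu hΔ hns hr hΔr hμ ?_) (not_le.2 h1)
  simp [r]

/-- Diagonal similarity fixes the diagonal entries, and |d| is an admissible positive scaling. -/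
lemma nuBar_le_of_diagonallyMaximal {G : Sys n} {d : Fin n → ℝ} (hd : ∀ i, d i ≠ 0) {k : Fin n}
    (h : ∀ i j, |diagConj d (magMatrix G) i j| ≤ |diagConj d (magMatrix G) k k|) :
    nuBar G ≤ ENNReal.ofReal (magMatrix G k k) := by
  have hk : |diagConj d (magMatrix G) k k| = magMatrix G k k := by
    rw [diagConj_apply, mul_right_comm, mul_inv_cancel₀ (hd k), one_mul,
      abs_of_nonneg (magMatrix_nonneg G k k)]
  refine nuBar_le (d := fun i => |d i|) (fun i => abs_pos.2 (hd i)) (magMatrix_nonneg G k k)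
    fun i j => ?_
  have h1 := h i j
  rwa [hk, diagConj_apply, abs_mul, abs_mul, abs_inv, ← div_eq_mul_inv,
    div_le_iff₀ (abs_pos.2 (hd j)), abs_of_nonneg (magMatrix_nonneg G i j)] at h1

lemma exists_magMatrix_ne_zero {G : Sys n} (hG : Stable G) (h : G ≠ 0) :
    ∃ i j, magMatrix G i j ≠ 0 := by
  by_contra! hz
  refine h (LinearMap.ext fun x => funext fun t => funext fun i => ?_)
  rw [apply_eq_sum_entry, Finset.sum_eq_zero]
  · rfl
  · intro j _
    rw [(magMatrix_eq_zero_iff hG i j).1 (hz i j)]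
    rfl

end Bounds

/-! ### Pure rings. -/

section Ring

variable {n : ℕ} {σ : Equiv.Perm (Fin n)}

/-- Link gains may vanish with Δ; raising them slightly makes them positive, as the choice of
potentials requires. -/
lemma exists_pos_ge_prod_lt_one {w : Fin n → ℝ} (hw : ∀ i, 0 ≤ w i) (h : ∏ i, w i < 1) :
    ∃ w' : Fin n → ℝ, (∀ i, 0 < w' i) ∧ (∀ i, w i ≤ w' i) ∧ ∏ i, w' i < 1 := by
  have hcont : Continuous fun ε : ℝ => ∏ i, (w i + ε) :=
    continuous_finsetProd _ fun i _ => continuous_const.add continuous_id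
  have h1 : ∀ᶠ ε in nhdsWithin (0 : ℝ) (Set.Ioi 0), ∏ i, (w i + ε) < 1 :=
    ((hcont.tendsto 0).mono_left nhdsWithin_le_nhds).eventually_lt_const (by simpa using h)
  obtain ⟨ε, h2, h3⟩ := (h1.and self_mem_nhdsWithin).exists
  have h4 : 0 < ε := h3
  exact ⟨fun i => w i + ε, fun i => add_pos_of_nonneg_of_pos (hw i) h4,
    fun i => le_add_of_nonneg_right h4.le, h2⟩

lemma IsPureRing.magMatrix_eq_zero {G : Sys n} (hG : Stable G) (h : IsPureRing G σ) {i j : Fin n}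
    (hj : j ≠ σ i) : magMatrix G i j = 0 := by
  rw [magMatrix_eq_zero_iff hG]
  by_contra h0
  exact hj ((h.2 i j).1 h0)

lemma IsPureRing.magMatrix_pos {G : Sys n} (hG : Stable G) (h : IsPureRing G σ) (i : Fin n) :
    0 < magMatrix G i (σ i) :=
  (magMatrix_nonneg G _ _).lt_of_ne' fun h0 =>
    (h.2 i (σ i)).2 rfl ((magMatrix_eq_zero_iff hG i (σ i)).1 h0)

/-- Each row of the loop has a single link. Dividing the gains by their geometric mean c makes their
product 1, so potentials exist that give every link weighted gain at most c < 1. -/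
lemma IsPureRing.loopStable (hn : 1 ≤ n) {G Δ : Sys n} (hG : Stable G) (h : IsPureRing G σ)
    (hΔ : Δ ∈ diagLTV n)
    (hlt : (∏ i, magMatrix G i (σ i)) * ∏ i, magMatrix Δ i i < 1) : LoopStable G Δ := by
  obtain ⟨w, hw0, hw, hw1⟩ := exists_pos_ge_prod_lt_one
    (w := fun i => magMatrix G i (σ i) * magMatrix Δ (σ i) (σ i))
    (fun i => mul_nonneg (magMatrix_nonneg _ _ _) (magMatrix_nonneg _ _ _))
    (by rwa [Finset.prod_mul_distrib, Equiv.prod_comp σ fun i => magMatrix Δ i i])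
  have hP : 0 < ∏ i, w i := Finset.prod_pos fun i _ => hw0 i
  have hn0 : n ≠ 0 := by omega
  set c : ℝ := (∏ i, w i) ^ ((n : ℝ)⁻¹) with hc
  have hc0 : 0 < c := Real.rpow_pos_of_pos hP _
  have hcn : c ^ n = ∏ i, w i := Real.rpow_inv_natCast_pow hP.le hn0
  have hc1 : c < 1 := (pow_lt_one_iff_of_nonneg hc0.le hn0).1 (hcn ▸ hw1)
  obtain ⟨d, hd, hds⟩ := exists_potential_of_isCycleOn hn h.1 (b := fun i => w i / c)
    (by rw [Finset.prod_div_distrib, Finset.prod_const, Finset.card_univ, Fintype.card_fin, hcn,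
      div_self hP.ne']) fun i => (div_pos (hw0 i) hc0).le
  refine loopStable_of_weights hG hΔ hd hc0.le hc1 fun i => ?_
  rw [Finset.sum_eq_single (σ i) (fun j _ hj => by simp [h.magMatrix_eq_zero hG hj]) (by simp),
    div_le_iff₀ (hd _), hds, mul_assoc]
  calc d i * (magMatrix G i (σ i) * magMatrix Δ (σ i) (σ i)) ≤ d i * w i :=
        mul_le_mul_of_nonneg_left (hw i) (hd i).le
    _ = c * (w i / c * d i) := by field_simp

/-- The product of the entries picked out by a permutation is invariant under diagonal similarity,
and each of its n factors is at most the largest entry. -/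
lemma prod_le_oneInfNorm_pow {A : Matrix (Fin n) (Fin n) ℝ} (hA : ∀ i j, 0 ≤ A i j)
    {d : Fin n → ℝ} (hd : ∀ i, 0 < d i) :
    ∏ i, A i (σ i) ≤ (oneInfNorm (diagConj d A)).toReal ^ n := by
  have h1 : ∏ i, A i (σ i) = ∏ i, diagConj d A i (σ i) := by
    simp only [diagConj_apply]
    rw [Finset.prod_mul_distrib, Finset.prod_mul_distrib, Equiv.prod_comp σ fun i => (d i)⁻¹,
      Finset.prod_inv_distrib, mul_right_comm,
      mul_inv_cancel₀ (Finset.prod_pos fun i _ => hd i).ne', one_mul]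
  rw [h1]
  refine (Finset.prod_le_prod (fun i _ => ?_) fun i _ =>
    (le_abs_self _).trans (abs_apply_le_oneInfNorm (diagConj d A) i (σ i))).trans_eq (by simp)
  rw [diagConj_apply]
  exact mul_nonneg (mul_nonneg (hd i).le (hA _ _)) (inv_nonneg.2 (hd _).le)

/-- A destabilizing Δ needs cycle gain at least 1. The link product is at most mⁿ and, by AM-GM, ∏
‖δ_i‖ ≤ (∑ ‖δ_i‖ / n)ⁿ; hence m ∑ ‖δ_i‖ ≥ n. -/
lemma IsPureRing.mul_nu_le_nuBar (hn : 1 ≤ n) {G : Sys n} (hG : Stable G) (h : IsPureRing G σ) :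
    n * nu G ≤ nuBar G := by
  have hn0 : (0 : ℝ) < n := by exact_mod_cast hn
  refine le_iInf₂ fun d hd => ?_
  have h1 := prod_le_oneInfNorm_pow (σ := σ) (magMatrix_nonneg G) hd
  rw [← ENNReal.ofReal_toReal (oneInfNorm_ne_top (diagConj d (magMatrix G)))]
  set m := (oneInfNorm (diagConj d (magMatrix G))).toReal
  have hm : 0 ≤ m := ENNReal.toReal_nonneg
  have h2 : nu G ≤ ENNReal.ofReal (m / n) := by
    refine nu_le (by positivity) fun Δ hΔ hns => ?_
    have hΔ0 := fun i => magMatrix_nonneg Δ i i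
    have hs : 0 ≤ ∑ i, magMatrix Δ i i := Finset.sum_nonneg fun i _ => hΔ0 i
    have h3 := not_lt.1 fun hlt => hns (h.loopStable hn hG hΔ hlt)
    have h4 := mul_le_mul h1 (prod_le_mean_pow hn hΔ0)
      (Finset.prod_nonneg fun i _ => hΔ0 i) (by positivity)
    rw [← mul_pow] at h4
    have h5 := (one_le_pow_iff_of_nonneg (by positivity) (by omega)).1 (h3.trans h4)
    calc (1 : ℝ) ≤ m * ((∑ i, magMatrix Δ i i) / n) := h5
      _ = m / n * ∑ i, magMatrix Δ i i := by ring
  calc (n : ℝ≥0∞) * nu G ≤ n * ENNReal.ofReal (m / n) := by gcongr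
    _ = ENNReal.ofReal m := by
      rw [← ENNReal.ofReal_natCast, ← ENNReal.ofReal_mul hn0.le, mul_div_cancel₀ _ hn0.ne']

lemma IsPureRing.nuBar_ne_zero (hn : 1 ≤ n) {G : Sys n} (hG : Stable G) (h : IsPureRing G σ) :
    nuBar G ≠ 0 := by
  have hn0 : n ≠ 0 := by omega
  have hP : 0 < ∏ i, magMatrix G i (σ i) := Finset.prod_pos fun i _ => h.magMatrix_pos hG i
  have h1 : ENNReal.ofReal ((∏ i, magMatrix G i (σ i)) ^ ((n : ℝ)⁻¹)) ≤ nuBar G := by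
    refine le_iInf₂ fun d hd => ENNReal.ofReal_le_of_le_toReal ?_
    rw [← pow_le_pow_iff_left₀ (Real.rpow_nonneg hP.le _) ENNReal.toReal_nonneg hn0,
      Real.rpow_inv_natCast_pow hP.le hn0]
    exact prod_le_oneInfNorm_pow (magMatrix_nonneg G) hd
  exact ((ENNReal.ofReal_pos.2 (Real.rpow_pos_of_pos hP _)).trans_le h1).ne'

end Ring

end NuGap

end

/-! ### Assembly of the three claims. -/

theorem mainTheorem3 (n : ℕ) (hn : 1 ≤ n) (G : NuGap.Sys n)
    (hcausal : NuGap.Causal G) (hstable : NuGap.Stable G) (hti : NuGap.TimeInvariant G) :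
    -- the two bounds, without and with division
    (NuGap.nuBar G < ∞ ∧ NuGap.nu G ≤ NuGap.nuBar G ∧ NuGap.nuBar G ≤ n * NuGap.nu G ∧
      (NuGap.nu G ≠ 0 →
        1 ≤ NuGap.nuBar G / NuGap.nu G ∧ NuGap.nuBar G / NuGap.nu G ≤ n)) ∧
    -- the lower bound is attained after a diagonal similarity to a diagonally maximal system
    ((∃ d : Fin n → ℝ, (∀ i, d i ≠ 0) ∧
        NuGap.DiagonallyMaximal (NuGap.diagConj d (NuGap.magMatrix G))) →
      NuGap.nuBar G = NuGap.nu G ∧ (G ≠ 0 → NuGap.nuBar G / NuGap.nu G = 1)) ∧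
    -- pure rings attain the upper bound; the singularity condition of a normalized ring
    (∀ σ : Equiv.Perm (Fin n), NuGap.IsPureRing G σ →
      NuGap.nuBar G / NuGap.nu G = n ∧
      ((∀ i, NuGap.magMatrix G i (σ i) = 1) →
        ∀ δ : Fin n → ℝ, (∀ i, 0 ≤ δ i) →
          ((1 - NuGap.magMatrix G * Matrix.diagonal δ).det = 0 ↔ ∏ i, δ i = 1) ∧
          (∏ i, δ i = 1 → (n : ℝ) ≤ ∑ i, δ i))) := by
  have htop := NuGap.nuBar_lt_top G
  have hle := NuGap.nu_le_nuBar hstable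
  have hge := NuGap.nuBar_le_mul_nu hn hcausal hti
  have hnutop : NuGap.nu G ≠ ∞ := (hle.trans_lt htop).ne
  refine ⟨⟨htop, hle, hge, fun h0 => ⟨?_, ENNReal.div_le_of_le_mul hge⟩⟩, ?_, ?_⟩
  · rwa [ENNReal.le_div_iff_mul_le (Or.inl h0) (Or.inl hnutop), one_mul]
  · rintro ⟨d, hd, k, hk⟩
    have h1 := NuGap.nuBar_le_of_diagonallyMaximal hd hk
    have h2 := NuGap.diag_le_nu hn hcausal hti k
    have heq : NuGap.nuBar G = NuGap.nu G := le_antisymm (h1.trans h2) hle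
    refine ⟨heq, fun hG => ?_⟩
    rw [heq]
    -- If ν were 0, the maximal diagonal entry would be 0 and with it all of M, contradicting G ≠ 0.
    refine ENNReal.div_self (fun h0 => ?_) hnutop
    obtain ⟨i, j, hij⟩ := NuGap.exists_magMatrix_ne_zero hstable hG
    rw [h0, nonpos_iff_eq_zero, ENNReal.ofReal_eq_zero] at h2
    have h3 := hk i j
    rw [NuGap.diagConj_apply d _ k k, le_antisymm h2 (NuGap.magMatrix_nonneg G k k), mul_zero,
      zero_mul, abs_zero, abs_nonpos_iff, NuGap.diagConj_apply] at h3
    exact mul_ne_zero (mul_ne_zero (hd i) hij) (inv_ne_zero (hd j)) h3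
  · intro σ hσ
    have heq : NuGap.nuBar G = n * NuGap.nu G := le_antisymm hge (hσ.mul_nu_le_nuBar hn hstable)
    have h0 : NuGap.nu G ≠ 0 := fun h0 =>
      hσ.nuBar_ne_zero hn hstable (by rw [heq, h0, mul_zero])
    refine ⟨by rw [heq, ENNReal.mul_div_cancel_right h0 hnutop], fun hM δ hδ => ⟨?_, fun h => ?_⟩⟩
    · rw [NuGap.det_one_sub_eq_zero_iff_of_isCycleOn hn hσ.1]
      · simp only [Matrix.mul_diagonal, hM, one_mul]
        rw [Equiv.prod_comp σ δ]
      · intro i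
        rw [Matrix.mul_diagonal]
        exact mul_nonneg (NuGap.magMatrix_nonneg G _ _) (hδ _)
      · intro i j hj
        rw [Matrix.mul_diagonal, hσ.magMatrix_eq_zero hstable hj, zero_mul]
    · have hn0 : (0 : ℝ) < n := by exact_mod_cast hn
      have h1 := NuGap.prod_le_mean_pow hn hδ
      rw [h, one_le_pow_iff_of_nonneg
        (div_nonneg (Finset.sum_nonneg fun i _ => hδ i) hn0.le) (by omega), one_le_div hn0] at h1
      exact h1
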